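/- Let $0=\tau_0<\tau_1<\dots<\tau_N$ be dates and write $\tau=\tau_N$. For $n=1,\dots,N$ let $\sigma^{(n)}\in\mathbb R$ and let $\nu^{(n)}$ be a Lévy measure on $\mathbb R$, i.e. $\nu^{(n)}(\{0\})=0$ and $\int\min(1,y^2)\,\nu^{(n)}(dy)<\infty$. On a probability space $(\Omega,\mathcal F,\mathbb Q)$ let $W$ be a standard Brownian motion and let $\mu$ be a Poisson random measure on $\mathbb R\times\mathbb R$ (jump size, time), independent of $W$, with compensator $\nu(dy,ds)=\nu^{(n)}(dy)\,ds$ for $s\in[\tau_{n-1},\tau_n)$, $n=1,\dots,N$ (and $0$ for $s\notin[0,\tau)$). Let $\sigma_s=\sigma^{(n)}$ for $s\in[\tau_{n-1},\tau_n)$. For $\omega\in\mathbb R$ put $$\Psi^{(n)}(\omega)=-\tfrac12(\sigma^{(n)})^2\omega^2+\int_{\mathbb R}\left(e^{i\omega y}-1-i\omega y\,\mathbf 1_{|y|\le1}\right)\nu^{(n)}(dy).$$ (a) If $X$ is the Lévy additive process $$X_t=\int_0^t\!\!\int_{|y|\le1}y\,[\mu(dy,ds)-\nu(dy,ds)]+\int_0^t\!\!\int_{|y|>1}y\,\mu(dy,ds)+\int_0^t\sigma_s\,dW_s\quad\text{a.s.},\qquad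 0\le t\le\tau,$$ then for every $\omega\in\mathbb R$ $$\mathbb E^{\mathbb Q}\left[e^{i\omega X_\tau}\right]=\exp\left(\sum_{n=1}^N\Psi^{(n)}(\omega)\,(\tau_n-\tau_{n-1})\right).$$ (b) If $\int_{|y|>1}|y|\,\nu^{(n)}(dy)<\infty$ for every $n$ and all jumps are compensated, that is, $$X_t=\int_0^t\!\!\int_{\mathbb R}y\,[\mu(dy,ds)-\nu(dy,ds)]+\int_0^t\sigma_s\,dW_s\quad\text{a.s.},\qquad 0\le t\le\tau,$$ then for every $\omega\in\mathbb R$ $$\mathbb E^{\mathbb Q}\left[e^{i\omega X_\tau}\right]=\exp\left(\sum_{n=1}^N\left(\Psi^{(n)}(\omega)-i\omega\int_{|y|>1}y\,\nu^{(n)}(dy)\right)(\tau_n-\tau_{n-1})\right).$$ The compensated integrals are the limits in probability, as $\varepsilon\downarrow0$, of the integrals restricted to $|y|>\varepsilon$. -/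

import Mathlib

open MeasureTheory ProbabilityTheory Filter Topology
open scoped NNReal ENNReal

noncomputable section

/-- A Lévy measure on the real line: no mass at `0`, and `∫ min(1, y²) ν(dy) < ∞`. -/
def IsLevyMeasure (ν : Measure ℝ) : Prop :=
  ν {0} = 0 ∧ Integrable (fun y : ℝ => min 1 (y ^ 2)) ν

/-- `M` is a Poisson random measure with intensity (compensator) `Λ`: `M B` is Poisson
distributed with mean `Λ B` for every measurable `B` (and a.s. infinite if `Λ B = ∞`), and the
masses of pairwise disjoint sets are independent. -/
structure IsPoissonRandomMeasure {Ω E : Type*} [MeasurableSpace Ω] [MeasurableSpace E]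
    (P : Measure Ω) (M : Ω → Measure E) (Λ : Measure E) : Prop where
  measurable : Measurable M
  law : ∀ B : Set E, MeasurableSet B → Λ B ≠ ∞ →
    HasLaw (fun ω => M ω B)
      ((poissonMeasure (Λ B).toNNReal).map (Nat.cast : ℕ → ℝ≥0∞)) P
  law_top : ∀ B : Set E, MeasurableSet B → Λ B = ∞ → ∀ᵐ ω ∂P, M ω B = ∞
  indep : ∀ (k : ℕ) (B : Fin k → Set E), (∀ i, MeasurableSet (B i)) →
    Pairwise (Function.onFun Disjoint B) → iIndepFun (fun i ω => M ω (B i)) P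

/-- The compensator `ν(dy, ds) = ν⁽ⁿ⁾(dy) ds` for `s ∈ [τₙ₋₁, τₙ)`, a measure on pairs `(y, s)`
(jump size, time). Periods are indexed by `Fin N`, so that period `n` is
`[τ n.castSucc, τ n.succ)`. -/
def additiveCompensator {N : ℕ} (τ : Fin (N + 1) → ℝ≥0) (ν : Fin N → Measure ℝ) :
    Measure (ℝ × ℝ) :=
  Measure.sum fun n : Fin N =>
    (ν n).prod (volume.restrict (Set.Ico (τ n.castSucc : ℝ) (τ n.succ : ℝ)))

/-- `∫_{[0,t]} ∫_A y m(dy, ds)`. -/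
def jumpIntegral (m : Measure (ℝ × ℝ)) (A : Set ℝ) (t : ℝ) : ℝ :=
  ∫ z in A ×ˢ Set.Icc 0 t, z.1 ∂m

/-- `Y = ∫_{[0,t]} ∫_A y [M(dy, ds) - Λ(dy, ds)]`: the limit in probability, as `ε ↓ 0`, of the
compensated sums of the jumps in `A` of size larger than `ε`. -/
def IsCompensatedJumpIntegral {Ω : Type*} [MeasurableSpace Ω] (P : Measure Ω)
    (M : Ω → Measure (ℝ × ℝ)) (Λ : Measure (ℝ × ℝ)) (A : Set ℝ) (t : ℝ) (Y : Ω → ℝ) : Prop :=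
  TendstoInMeasure P
    (fun (ε : ℝ) ω =>
      jumpIntegral (M ω) (A ∩ {y | ε < |y|}) t - jumpIntegral Λ (A ∩ {y | ε < |y|}) t)
    (𝓝[>] 0) Y

/-- `∫_0^t σ_s dW_s` for the deterministic step integrand equal to `σ⁽ⁿ⁾` on period `n`. -/
def stepWienerIntegral {Ω : Type*} {N : ℕ} (τ : Fin (N + 1) → ℝ≥0) (σ : Fin N → ℝ)
    (W : ℝ≥0 → Ω → ℝ) (t : ℝ≥0) (ω : Ω) : ℝ :=
  ∑ n : Fin N, σ n * (W (min t (τ n.succ)) ω - W (min t (τ n.castSucc)) ω)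

/-- The Lévy additive process on `[0, τ_N]` in Lévy–Itô form (jumps of size at most one are
compensated):
`X_t = ∫_0^t ∫_{|y| ≤ 1} y [μ(dy,ds) - ν(dy,ds)] + ∫_0^t ∫_{|y| > 1} y μ(dy,ds) + ∫_0^t σ_s dW_s`.
-/
def IsLevyAdditive {Ω : Type*} [MeasurableSpace Ω] (P : Measure Ω) {N : ℕ}
    (τ : Fin (N + 1) → ℝ≥0) (σ : Fin N → ℝ) (ν : Fin N → Measure ℝ)
    (W : ℝ≥0 → Ω → ℝ) (M : Ω → Measure (ℝ × ℝ)) (X : ℝ≥0 → Ω → ℝ) : Prop :=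
  ∀ t ≤ τ (Fin.last N), ∃ Y : Ω → ℝ,
    IsCompensatedJumpIntegral P M (additiveCompensator τ ν) {y | |y| ≤ 1} t Y ∧
    X t =ᵐ[P] fun ω =>
      Y ω + jumpIntegral (M ω) {y | 1 < |y|} t + stepWienerIntegral τ σ W t ω

/-- The Lévy additive process on `[0, τ_N]` with all its jumps compensated:
`X_t = ∫_0^t ∫_ℝ y [μ(dy,ds) - ν(dy,ds)] + ∫_0^t σ_s dW_s`. -/
def IsFullyCompensatedLevyAdditive {Ω : Type*} [MeasurableSpace Ω] (P : Measure Ω) {N : ℕ}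
    (τ : Fin (N + 1) → ℝ≥0) (σ : Fin N → ℝ) (ν : Fin N → Measure ℝ)
    (W : ℝ≥0 → Ω → ℝ) (M : Ω → Measure (ℝ × ℝ)) (X : ℝ≥0 → Ω → ℝ) : Prop :=
  ∀ t ≤ τ (Fin.last N), ∃ Y : Ω → ℝ,
    IsCompensatedJumpIntegral P M (additiveCompensator τ ν) Set.univ t Y ∧
    X t =ᵐ[P] fun ω => Y ω + stepWienerIntegral τ σ W t ω

/-- `Ψ(u) = -σ²u²/2 + ∫ (e^{iuy} - 1 - i u y 1_{|y| ≤ 1}) ν(dy)`. -/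
def levyKhintchineExponent (σ : ℝ) (ν : Measure ℝ) (u : ℝ) : ℂ :=
  -(1 / 2 : ℂ) * (σ : ℂ) ^ 2 * (u : ℂ) ^ 2 +
    ∫ y : ℝ, (Complex.exp (Complex.I * u * y) - 1 -
      (if |y| ≤ 1 then Complex.I * u * y else 0)) ∂ν

end

/-!
The proof computes the characteristic function of the jumps of size larger than `ε` and lets
`ε ↓ 0`.

On a set `B` of finite intensity, the exponential formula
`𝔼[exp(iu ∫_B f dM)] = exp(∫_B (e^{iuf} - 1) dΛ)` holds
(`IsPoissonRandomMeasure.integral_cexp_setIntegral`): for simple `f` the integral is a linear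
combination of independent Poisson variables, and dominated convergence extends it to measurable
`f`. No representation of `M` by point masses is available, so integrability of `f` under almost
every `M ω` has to come from the integer values of the masses
(`IsPoissonRandomMeasure.ae_integrableOn`).

Both parts of the theorem are instances of one statement, `integral_cexp_levyIto`, in which the
jumps in a set `s ⊇ {|y| ≤ 1}` are compensated: `s = {|y| ≤ 1}` for the first part and `s = ℝ` for the
second. Since the first marginal of the compensator is `∑ₙ (τₙ - τₙ₋₁) ν⁽ⁿ⁾`
(`map_fst_restrict_additiveCompensator`), the truncated jumps contribute
`∑ₙ (τₙ - τₙ₋₁) ∫_{|y| > ε} (e^{iuy} - 1 - iuy 1_s(y)) ν⁽ⁿ⁾(dy)` to the exponent. The integrand is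
`O(min(1, y²))`, up to `y` on the large jumps in `s`, hence integrable, which gives the limit. The
Brownian part is independent of the jumps and contributes its Gaussian characteristic function
(`integral_cexp_stepWienerIntegral`).
-/

/-! ### Integrals against a Poisson random measure -/

section PoissonRandomMeasure

variable {Ω E : Type*} [MeasurableSpace Ω] [MeasurableSpace E] {P : Measure Ω}
  {M : Ω → Measure E} {Λ : Measure E}

namespace IsPoissonRandomMeasure

lemma ae_exists_eq_natCast (hM : IsPoissonRandomMeasure P M Λ) {B : Set E}
    (hB : MeasurableSet B) (hΛ : Λ B ≠ ∞) : ∀ᵐ ω ∂P, ∃ n : ℕ, M ω B = n := by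
  have hS : MeasurableSet {x : ℝ≥0∞ | ∃ n : ℕ, x = n} := by
    have : {x : ℝ≥0∞ | ∃ n : ℕ, x = n} = Set.range ((↑) : ℕ → ℝ≥0∞) := by
      ext x; simp [eq_comm]
    rw [this]
    exact (Set.countable_range _).measurableSet
  refine ((hM.law B hB hΛ).ae_iff (p := fun x => ∃ n : ℕ, x = n)
    (measurableSet_setOfPred.1 hS)).2 ?_
  rw [ae_map_iff (by fun_prop) hS]
  exact Eventually.of_forall fun n => ⟨n, rfl⟩

/-- Since the mass of `B ∩ {k < |f|}` is an integer that decreases to `0` as `k → ∞`, it vanishes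
for some `k`: almost surely `f` is essentially bounded on `B`. -/
lemma ae_integrableOn (hM : IsPoissonRandomMeasure P M Λ) {B : Set E} (hB : MeasurableSet B)
    (hΛ : Λ B ≠ ∞) {f : E → ℝ} (hf : Measurable f) : ∀ᵐ ω ∂P, IntegrableOn f B (M ω) := by
  let S : ℕ → Set E := fun k => B ∩ {x | (k : ℝ) < |f x|}
  have hS : ∀ k, MeasurableSet (S k) := fun k =>
    hB.inter (measurableSet_lt measurable_const hf.abs)
  have hSB : ∀ k, S k ⊆ B := fun k => Set.inter_subset_left
  have hnat : ∀ᵐ ω ∂P, ∀ k, ∃ n : ℕ, M ω (S k) = n := ae_all_iff.2 fun k =>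
    hM.ae_exists_eq_natCast (hS k) (ne_top_of_le_ne_top hΛ (measure_mono (hSB k)))
  filter_upwards [hnat, hM.ae_exists_eq_natCast hB hΛ] with ω hω hωB
  have hfin : M ω B ≠ ∞ := by
    obtain ⟨n, hn⟩ := hωB
    simp [hn]
  have hanti : Antitone S := fun j k hjk x hx =>
    ⟨hx.1, show (j : ℝ) < |f x| from lt_of_le_of_lt (Nat.cast_le.2 hjk) hx.2⟩
  have hempty : ⋂ k, S k = ∅ := by
    refine Set.eq_empty_of_forall_notMem fun x hx => ?_
    obtain ⟨k, hk⟩ := exists_nat_ge |f x|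
    exact absurd (Set.mem_iInter.1 hx k).2 (not_lt.2 hk)
  have hlim := tendsto_measure_iInter_atTop (μ := M ω) (fun k => (hS k).nullMeasurableSet) hanti
    ⟨0, ne_top_of_le_ne_top hfin (measure_mono (hSB 0))⟩
  rw [hempty, measure_empty] at hlim
  obtain ⟨k, hk⟩ := (hlim.eventually_lt_const one_pos).exists
  have hk0 : M ω (S k) = 0 := by
    obtain ⟨n, hn⟩ := hω k
    simp only [Function.comp_apply, hn] at hk
    rw [hn]
    have : n < 1 := by exact_mod_cast hk
    simp [Nat.lt_one_iff.1 this]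
  refine Measure.integrableOn_of_bounded hfin hf.aestronglyMeasurable (M := k) ?_
  rw [ae_restrict_iff' hB]
  have : ∀ᵐ x ∂(M ω), x ∉ S k := measure_eq_zero_iff_ae_notMem.1 hk0
  filter_upwards [this] with x hx hxB
  by_contra hlt
  exact hx ⟨hxB, not_le.1 hlt⟩

/-- The integral over a set of finite intensity is almost surely a measurable functional of the
random measure, namely the difference of the lower integrals of the positive and negative parts. -/
lemma exists_measurable_setIntegral (hM : IsPoissonRandomMeasure P M Λ) {B : Set E}
    (hB : MeasurableSet B) (hΛ : Λ B ≠ ∞) {f : E → ℝ} (hf : Measurable f) :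
    ∃ φ : Measure E → ℝ, Measurable φ ∧ (fun ω => ∫ x in B, f x ∂(M ω)) =ᵐ[P] φ ∘ M := by
  refine ⟨fun m => (∫⁻ x in B, ENNReal.ofReal (f x) ∂m).toReal
    - (∫⁻ x in B, ENNReal.ofReal (-f x) ∂m).toReal, ?_, ?_⟩
  · have hres : Measurable fun m : Measure E => m.restrict B :=
      Measure.measurable_of_measurable_coe _ fun s hs => by
        simpa only [Measure.restrict_apply hs] using Measure.measurable_coe (hs.inter hB)
    exact ((Measure.measurable_lintegral hf.ennreal_ofReal).comp hres).ennreal_toReal.sub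
      ((Measure.measurable_lintegral hf.neg.ennreal_ofReal).comp hres).ennreal_toReal
  · filter_upwards [hM.ae_integrableOn hB hΛ hf] with ω hω
    exact integral_eq_lintegral_pos_part_sub_lintegral_neg_part hω

lemma aemeasurable_setIntegral (hM : IsPoissonRandomMeasure P M Λ) {B : Set E}
    (hB : MeasurableSet B) (hΛ : Λ B ≠ ∞) {f : E → ℝ} (hf : Measurable f) :
    AEMeasurable (fun ω => ∫ x in B, f x ∂(M ω)) P := by
  obtain ⟨φ, hφ, h⟩ := hM.exists_measurable_setIntegral hB hΛ hf
  exact (hφ.comp hM.measurable).aemeasurable.congr h.symm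

lemma indep_of_fintype (hM : IsPoissonRandomMeasure P M Λ) {ι : Type*} [Fintype ι]
    {B : ι → Set E} (hB : ∀ i, MeasurableSet (B i))
    (hd : Pairwise (Function.onFun Disjoint B)) : iIndepFun (fun i ω => M ω (B i)) P := by
  let e := Fintype.equivFin ι
  have h := hM.indep _ (B ∘ e.symm) (fun i => hB _) (hd.comp_of_injective e.symm.injective)
  simpa using h.precomp e.injective

lemma integral_cexp_measure (hM : IsPoissonRandomMeasure P M Λ) {B : Set E}
    (hB : MeasurableSet B) (hΛ : Λ B ≠ ∞) (t : ℝ) :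
    ∫ ω, Complex.exp (Complex.I * t * ((M ω).real B : ℝ)) ∂P =
      Complex.exp ((Λ.real B : ℝ) * (Complex.exp (Complex.I * t) - 1)) := by
  have hg : Measurable fun x : ℝ≥0∞ => Complex.exp (Complex.I * t * (x.toReal : ℝ)) := by fun_prop
  have h := (hM.law B hB hΛ).integral_comp hg.aestronglyMeasurable
  rw [integral_map (by fun_prop) hg.aestronglyMeasurable] at h
  have hc := charFun_map_cast_poissonMeasure (Λ B).toNNReal t
  rw [charFun_apply, integral_map (by fun_prop) (by fun_prop)] at hc
  have hΛB : (((Λ B).toNNReal : ℝ) : ℂ) = ((Λ.real B : ℝ) : ℂ) := rfl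
  rw [hΛB, mul_comm (t : ℂ) Complex.I] at hc
  refine (Eq.trans h ?_).trans hc
  refine integral_congr_ae (Eventually.of_forall fun n => ?_)
  simp only [ENNReal.toReal_natCast, Real.inner_apply]
  congr 1
  push_cast
  ring

/-- The exponential formula for simple functions: the masses of the level sets are independent
Poisson variables. -/
lemma integral_cexp_setIntegral_simpleFunc [IsProbabilityMeasure P]
    (hM : IsPoissonRandomMeasure P M Λ)
    {B : Set E} (hB : MeasurableSet B) (hΛ : Λ B ≠ ∞) (g : SimpleFunc E ℝ) (u : ℝ) :
    ∫ ω, Complex.exp (Complex.I * u * ((∫ x in B, g x ∂(M ω) : ℝ) : ℂ)) ∂P =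
      Complex.exp (∫ x in B, (Complex.exp (Complex.I * u * g x) - 1) ∂Λ) := by
  have hS : ∀ y : ℝ, MeasurableSet (g ⁻¹' {y} ∩ B) := fun y => (g.measurableSet_fiber y).inter hB
  have hSΛ : ∀ y : ℝ, Λ (g ⁻¹' {y} ∩ B) ≠ ∞ := fun y =>
    ne_top_of_le_ne_top hΛ (measure_mono Set.inter_subset_right)
  have hind : iIndepFun (fun (y : g.range) ω => M ω (g ⁻¹' {(y : ℝ)} ∩ B)) P := by
    refine hM.indep_of_fintype (fun y => hS y) fun y z hyz => ?_
    refine Set.disjoint_left.2 fun x hx hx' => hyz (Subtype.ext ?_)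
    have h1 : g x = y := hx.1
    have h2 : g x = z := hx'.1
    exact h1.symm.trans h2
  have hL : ∀ᵐ ω ∂P, Complex.exp (Complex.I * u * ((∫ x in B, g x ∂(M ω) : ℝ) : ℂ)) =
      ∏ y : g.range, Complex.exp (Complex.I * (u * (y : ℝ) : ℝ) *
        ((M ω).real (g ⁻¹' {(y : ℝ)} ∩ B) : ℝ)) := by
    filter_upwards [hM.ae_integrableOn hB hΛ g.measurable] with ω hω
    rw [← SimpleFunc.integral_eq_integral g hω, SimpleFunc.integral_eq, ← Complex.exp_sum,
      ← Finset.sum_coe_sort g.range, Complex.ofReal_sum, Finset.mul_sum]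
    congr 1
    refine Finset.sum_congr rfl fun y _ => ?_
    rw [measureReal_restrict_apply (g.measurableSet_fiber _), smul_eq_mul]
    push_cast
    ring
  have hR : ∫ x in B, (Complex.exp (Complex.I * u * g x) - 1) ∂Λ =
      ∑ y : g.range, ((Λ.real (g ⁻¹' {(y : ℝ)} ∩ B) : ℝ) : ℂ) *
        (Complex.exp (Complex.I * (u * (y : ℝ) : ℝ)) - 1) := by
    have : IsFiniteMeasure (Λ.restrict B) := isFiniteMeasure_restrict.2 hΛ
    have h := SimpleFunc.map_integral (μ := Λ.restrict B) g
      (fun y : ℝ => Complex.exp (Complex.I * u * y) - 1) (g.integrable_of_isFiniteMeasure)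
      (by simp)
    rw [SimpleFunc.integral_eq_integral _ (SimpleFunc.integrable_of_isFiniteMeasure _)] at h
    refine Eq.trans (by simp) (h.trans ?_)
    rw [← Finset.sum_coe_sort g.range]
    refine Finset.sum_congr rfl fun y _ => ?_
    rw [measureReal_restrict_apply (g.measurableSet_fiber _), Complex.real_smul]
    push_cast
    ring_nf
  rw [integral_congr_ae hL, hR, Complex.exp_sum]
  have h := hind.integral_fun_prod_comp
    (f := fun (y : g.range) (x : ℝ≥0∞) =>
      Complex.exp (Complex.I * (u * (y : ℝ) : ℝ) * (x.toReal : ℝ)))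
    (fun y => (hM.law _ (hS y) (hSΛ y)).aemeasurable)
    (fun y => Measurable.aestronglyMeasurable (by fun_prop))
  refine h.trans (Finset.prod_congr rfl fun y _ => ?_)
  exact hM.integral_cexp_measure (hS y) (hSΛ y) _

/-- The exponential formula `𝔼[exp(iu ∫_B f dM)] = exp(∫_B (e^{iuf} - 1) dΛ)` on a set of finite
intensity. -/
lemma integral_cexp_setIntegral [IsProbabilityMeasure P] (hM : IsPoissonRandomMeasure P M Λ)
    {B : Set E} (hB : MeasurableSet B) (hΛ : Λ B ≠ ∞) {f : E → ℝ} (hf : Measurable f) (u : ℝ) :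
    ∫ ω, Complex.exp (Complex.I * u * ((∫ x in B, f x ∂(M ω) : ℝ) : ℂ)) ∂P =
      Complex.exp (∫ x in B, (Complex.exp (Complex.I * u * f x) - 1) ∂Λ) := by
  have hnorm : ∀ x : ℝ, ‖Complex.exp (Complex.I * u * x)‖ = 1 := fun x => by
    rw [mul_assoc, ← Complex.ofReal_mul, Complex.norm_exp_I_mul_ofReal]
  let g : ℕ → SimpleFunc E ℝ := SimpleFunc.approxOn f hf Set.univ 0 (Set.mem_univ 0)
  have hg : ∀ x, Tendsto (fun n => g n x) atTop (𝓝 (f x)) := fun x =>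
    SimpleFunc.tendsto_approxOn hf (Set.mem_univ 0) (by simp)
  have hgb : ∀ n x, ‖g n x‖ ≤ ‖f x‖ + ‖f x‖ := fun n x =>
    SimpleFunc.norm_approxOn_zero_le hf (Set.mem_univ 0) x n
  have hcont : Continuous fun x : ℝ => Complex.exp (Complex.I * u * x) := by fun_prop
  have hleft : Tendsto (fun n => ∫ ω, Complex.exp
      (Complex.I * u * ((∫ x in B, g n x ∂(M ω) : ℝ) : ℂ)) ∂P) atTop
      (𝓝 (∫ ω, Complex.exp (Complex.I * u * ((∫ x in B, f x ∂(M ω) : ℝ) : ℂ)) ∂P)) := by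
    refine tendsto_integral_of_dominated_convergence (fun _ => 1) (fun n => ?_)
      (integrable_const _) (fun n => ?_) ?_
    · exact (hcont.measurable.comp_aemeasurable
        (hM.aemeasurable_setIntegral hB hΛ (g n).measurable)).aestronglyMeasurable
    · exact Eventually.of_forall fun ω => (hnorm _).le
    · filter_upwards [hM.ae_integrableOn hB hΛ hf] with ω hω
      refine (hcont.tendsto _).comp ?_
      exact tendsto_integral_of_dominated_convergence (fun x => ‖f x‖ + ‖f x‖)
        (fun n => (g n).measurable.aestronglyMeasurable) (hω.norm.add hω.norm)
        (fun n => Eventually.of_forall (hgb n)) (Eventually.of_forall hg)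
  have : IsFiniteMeasure (Λ.restrict B) := isFiniteMeasure_restrict.2 hΛ
  have hright : Tendsto (fun n => ∫ x in B, (Complex.exp (Complex.I * u * g n x) - 1) ∂Λ) atTop
      (𝓝 (∫ x in B, (Complex.exp (Complex.I * u * f x) - 1) ∂Λ)) := by
    refine tendsto_integral_of_dominated_convergence (fun _ => 2) (fun n => ?_)
      (integrable_const _) (fun n => Eventually.of_forall fun x => ?_)
      (Eventually.of_forall fun x => ?_)
    · exact ((hcont.measurable.comp (g n).measurable).sub_const 1).aestronglyMeasurable
    · refine (norm_sub_le _ _).trans ?_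
      rw [hnorm, norm_one]
      norm_num
    · exact ((hcont.tendsto _).comp (hg x)).sub_const 1
  refine tendsto_nhds_unique hleft
    (((Complex.continuous_exp.tendsto _).comp hright).congr fun n => ?_)
  exact (hM.integral_cexp_setIntegral_simpleFunc hB hΛ (g n) u).symm

end IsPoissonRandomMeasure

end PoissonRandomMeasure

/-! ### The Wiener integral of a step function -/

section Wiener

lemma stepWienerIntegral_last {Ω : Type*} {N : ℕ} {τ : Fin (N + 1) → ℝ≥0} {σ : Fin N → ℝ}
    {W : ℝ≥0 → Ω → ℝ} (hτ : Monotone τ) (ω : Ω) :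
    stepWienerIntegral τ σ W (τ (Fin.last N)) ω =
      ∑ n : Fin N, σ n * (W (τ n.succ) ω - W (τ n.castSucc) ω) := by
  simp only [stepWienerIntegral, min_eq_right (hτ (Fin.le_last _))]

variable {Ω : Type*} [MeasurableSpace Ω] {P : Measure Ω} {N : ℕ}
  {τ : Fin (N + 1) → ℝ≥0} {σ : Fin N → ℝ} {W : ℝ≥0 → Ω → ℝ}

lemma aemeasurable_stepWienerIntegral (hW : IsPreBrownianReal W P) (t : ℝ≥0) :
    AEMeasurable (stepWienerIntegral τ σ W t) P := by
  have := hW.aemeasurable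
  unfold stepWienerIntegral
  fun_prop

/-- Independence of the increments of a Brownian motion turns the characteristic function of a
Wiener step integral into a product of Gaussian ones. -/
lemma integral_cexp_stepWienerIntegral (hτ : Monotone τ) (hW : IsPreBrownianReal W P) (u : ℝ) :
    ∫ ω, Complex.exp (Complex.I * u * stepWienerIntegral τ σ W (τ (Fin.last N)) ω) ∂P =
      Complex.exp (∑ n : Fin N, -(1 / 2 : ℂ) * (σ n : ℂ) ^ 2 * (u : ℂ) ^ 2 *
        ((τ n.succ : ℂ) - (τ n.castSucc : ℂ))) := by
  have hind := hW.hasIndepIncrements N τ hτ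
  have hm := hW.aemeasurable
  have h := hind.integral_fun_prod_comp
    (f := fun n (x : ℝ) => Complex.exp (Complex.I * u * (σ n * x)))
    (fun n => by fun_prop) (fun n => Measurable.aestronglyMeasurable (by fun_prop))
  have hL : ∀ ω, Complex.exp (Complex.I * u * stepWienerIntegral τ σ W (τ (Fin.last N)) ω) =
      ∏ n : Fin N, Complex.exp (Complex.I * u *
        (σ n * ((W (τ n.succ) ω - W (τ n.castSucc) ω : ℝ) : ℂ))) := fun ω => by
    rw [stepWienerIntegral_last hτ, ← Complex.exp_sum, ← Finset.mul_sum]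
    push_cast
    rfl
  simp only [hL]
  rw [h, Complex.exp_sum]
  refine Finset.prod_congr rfl fun n _ => ?_
  have hlaw : HasLaw (W (τ n.succ) - W (τ n.castSucc))
      (gaussianReal 0 (nndist (τ n.succ : ℝ) (τ n.castSucc : ℝ))) P :=
    hW.hasLaw_sub (τ n.succ) (τ n.castSucc)
  have h1 := charFun_gaussianReal (μ := 0)
    (v := nndist (τ n.succ : ℝ) (τ n.castSucc : ℝ)) (u * σ n)
  rw [← hlaw.map_eq, charFun_apply, integral_map hlaw.aemeasurable (by fun_prop)] at h1
  have hd : ((nndist (τ n.succ : ℝ) (τ n.castSucc : ℝ) : ℝ≥0) : ℝ) =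
      (τ n.succ : ℝ) - (τ n.castSucc : ℝ) := by
    rw [coe_nndist, Real.dist_eq, abs_of_nonneg]
    exact sub_nonneg.2 (NNReal.coe_le_coe.2 (hτ (Fin.castSucc_lt_succ).le))
  refine (integral_congr_ae (Eventually.of_forall fun ω => ?_)).trans (h1.trans ?_)
  · simp only [Real.inner_apply, Pi.sub_apply]
    congr 1
    push_cast
    ring
  · congr 1
    have hd' : (((nndist (τ n.succ : ℝ) (τ n.castSucc : ℝ) : ℝ≥0) : ℝ) : ℂ) =
      (τ n.succ : ℂ) - (τ n.castSucc : ℂ) := by rw [hd]; push_cast; rfl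
    rw [hd']
    push_cast
    ring

end Wiener

/-! ### Lévy measures and the compensated exponent -/

section LevyMeasure

variable {ν : Measure ℝ}

/-- The integrand `e^{iuy} - 1 - iuy 1_s(y)` of the Lévy–Khintchine exponent in which the jumps in
`s` are compensated. The choices `s = {|y| ≤ 1}` and `s = ℝ` give the two exponents of interest. -/
noncomputable def compensatedCexp (s : Set ℝ) (u y : ℝ) : ℂ :=
  Complex.exp (Complex.I * u * y) - 1 - s.indicator (fun y : ℝ => Complex.I * u * y) y

lemma norm_cexp_I_mul_mul (u y : ℝ) : ‖Complex.exp (Complex.I * u * y)‖ = 1 := by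
  rw [mul_assoc, ← Complex.ofReal_mul, Complex.norm_exp_I_mul_ofReal]

lemma measurable_compensatedCexp {s : Set ℝ} (hs : MeasurableSet s) (u : ℝ) :
    Measurable (compensatedCexp s u) := by
  unfold compensatedCexp
  exact Measurable.sub (by fun_prop) (Measurable.indicator (by fun_prop) hs)

lemma norm_cexp_sub_one_sub_le (x : ℝ) :
    ‖Complex.exp (Complex.I * x) - 1 - Complex.I * x‖ ≤ 2 * x ^ 2 := by
  have hx : ‖Complex.I * (x : ℂ)‖ = |x| := by simp
  rcases le_total |x| 1 with h | h
  · refine (Complex.norm_exp_sub_one_sub_id_le (hx.trans_le h)).trans ?_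
    rw [hx, sq_abs]
    nlinarith [sq_nonneg x]
  · refine (norm_sub_le _ _).trans ?_
    have h1 := Real.norm_exp_I_mul_ofReal_sub_one_le (x := x)
    rw [Real.norm_eq_abs] at h1
    rw [hx, ← sq_abs x]
    nlinarith

lemma norm_compensatedCexp_le (u y : ℝ) :
    ‖compensatedCexp {y | |y| ≤ 1} u y‖ ≤ (2 * u ^ 2 + 2) * min 1 (y ^ 2) := by
  by_cases hy : |y| ≤ 1
  · have h1 := norm_cexp_sub_one_sub_le (u * y)
    have hmin : min 1 (y ^ 2) = y ^ 2 := min_eq_right ((sq_le_one_iff_abs_le_one y).2 hy)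
    rw [compensatedCexp, Set.indicator_of_mem (by exact hy), hmin, mul_assoc, ← Complex.ofReal_mul]
    refine h1.trans ?_
    nlinarith [sq_nonneg y]
  · have hmin : min 1 (y ^ 2) = 1 :=
      min_eq_left (le_of_not_ge fun h => hy ((sq_le_one_iff_abs_le_one y).1 h))
    rw [compensatedCexp, Set.indicator_of_notMem (by exact hy), hmin, sub_zero]
    refine (norm_sub_le _ _).trans ?_
    rw [norm_cexp_I_mul_mul, norm_one]
    nlinarith [sq_nonneg u]

/-- Passing from the compensation of the jumps of size at most one to that of the jumps in a larger
set `s` only affects the large jumps. -/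
lemma compensatedCexp_eq_sub {s : Set ℝ} (hs : {y | |y| ≤ 1} ⊆ s) (u y : ℝ) :
    compensatedCexp s u y = compensatedCexp {y | |y| ≤ 1} u y -
      Complex.I * u * (((s ∩ {y | 1 < |y|}).indicator (fun y => y) y : ℝ) : ℂ) := by
  unfold compensatedCexp
  by_cases hy : |y| ≤ 1
  · rw [Set.indicator_of_mem (hs hy), Set.indicator_of_mem (s := {y | |y| ≤ 1}) (by exact hy),
      Set.indicator_of_notMem (fun h => absurd h.2 (not_lt.2 hy))]
    simp
  · rw [Set.indicator_of_notMem (s := {y | |y| ≤ 1}) (by exact hy)]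
    by_cases hys : y ∈ s
    · rw [Set.indicator_of_mem hys, Set.indicator_of_mem (by exact ⟨hys, not_le.1 hy⟩)]
      simp
    · rw [Set.indicator_of_notMem hys, Set.indicator_of_notMem (fun h => hys h.1)]
      simp

namespace IsLevyMeasure

lemma integrable_compensatedCexp_abs_le_one (hν : IsLevyMeasure ν) (u : ℝ) :
    Integrable (compensatedCexp {y | |y| ≤ 1} u) ν :=
  (hν.2.const_mul (2 * u ^ 2 + 2)).mono'
    (measurable_compensatedCexp (measurableSet_le measurable_norm measurable_const)
      u).aestronglyMeasurable
    (Eventually.of_forall (norm_compensatedCexp_le u))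

lemma integrable_compensatedCexp (hν : IsLevyMeasure ν) {s : Set ℝ} (hsm : MeasurableSet s)
    (hs : {y | |y| ≤ 1} ⊆ s) (hint : IntegrableOn (fun y : ℝ => y) (s ∩ {y | 1 < |y|}) ν) (u : ℝ) :
    Integrable (compensatedCexp s u) ν := by
  have hm : MeasurableSet (s ∩ {y : ℝ | 1 < |y|}) :=
    hsm.inter (measurableSet_lt measurable_const measurable_norm)
  rw [funext (compensatedCexp_eq_sub hs u)]
  exact (hν.integrable_compensatedCexp_abs_le_one u).sub
    (((integrable_indicator_iff hm).2 hint).ofReal.const_mul _)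

lemma measure_lt_abs_ne_top (hν : IsLevyMeasure ν) {ε : ℝ} (hε : 0 < ε) :
    ν {y | ε < |y|} ≠ ∞ := by
  have hδ : 0 < min 1 (ε ^ 2) := lt_min one_pos (by positivity)
  refine ne_top_of_le_ne_top (hν.2.measure_norm_ge_lt_top hδ).ne (measure_mono fun y hy => ?_)
  have hy' : ε < |y| := hy
  have h2 : ε ^ 2 ≤ y ^ 2 := by rw [← sq_abs y]; gcongr
  simp only [Set.mem_ofPred_eq]
  rw [Real.norm_of_nonneg (le_min zero_le_one (sq_nonneg y))]
  exact min_le_min_left 1 h2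

lemma sigmaFinite (hν : IsLevyMeasure ν) : SigmaFinite ν := by
  refine ⟨⟨⟨fun n => {y | 1 / ((n : ℝ) + 1) < |y|} ∪ {0}, fun _ => trivial, fun n => ?_, ?_⟩⟩⟩
  · refine (measure_union_le _ _).trans_lt ?_
    rw [hν.1, add_zero]
    exact (hν.measure_lt_abs_ne_top (by positivity)).lt_top
  · refine Set.eq_univ_of_forall fun y => Set.mem_iUnion.2 ?_
    by_cases hy : y = 0
    · exact ⟨0, Or.inr hy⟩
    · obtain ⟨n, hn⟩ := exists_nat_one_div_lt (abs_pos.2 hy)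
      exact ⟨n, Or.inl hn⟩

/-- Removing the truncation loses nothing: the only size that no truncation level reaches is `0`,
which has no mass. -/
lemma tendsto_setIntegral_lt_abs (hν : IsLevyMeasure ν) {f : ℝ → ℂ} (hf : Integrable f ν) :
    Tendsto (fun ε => ∫ y in {y | ε < |y|}, f y ∂ν) (𝓝[>] 0) (𝓝 (∫ y, f y ∂ν)) := by
  have hm : ∀ ε : ℝ, MeasurableSet {y : ℝ | ε < |y|} := fun ε =>
    measurableSet_lt measurable_const measurable_norm
  simp only [← integral_indicator (hm _)]
  refine tendsto_integral_filter_of_dominated_convergence (fun y => ‖f y‖)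
    (Eventually.of_forall fun ε => hf.aestronglyMeasurable.indicator (hm ε))
    (Eventually.of_forall fun ε => Eventually.of_forall fun y => norm_indicator_le_norm_self _ _)
    hf.norm ?_
  have h0 : ∀ᵐ y ∂ν, y ∉ ({0} : Set ℝ) := measure_eq_zero_iff_ae_notMem.1 hν.1
  filter_upwards [h0] with y hy
  refine tendsto_const_nhds.congr' ?_
  have hpos : 0 < |y| := abs_pos.2 hy
  filter_upwards [mem_nhdsWithin_of_mem_nhds (Iio_mem_nhds hpos)] with ε hε
  exact (Set.indicator_of_mem (s := {y : ℝ | ε < |y|}) hε f).symm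

end IsLevyMeasure

lemma levyKhintchineExponent_eq (σ : ℝ) (ν : Measure ℝ) (u : ℝ) :
    levyKhintchineExponent σ ν u = -(1 / 2 : ℂ) * (σ : ℂ) ^ 2 * (u : ℂ) ^ 2 +
      ∫ y, compensatedCexp {y | |y| ≤ 1} u y ∂ν := by
  unfold levyKhintchineExponent compensatedCexp
  simp only [Set.indicator_apply, Set.mem_ofPred_eq]

lemma levyKhintchineExponent_sub_eq (hν : IsLevyMeasure ν) (σ : ℝ)
    (hint : IntegrableOn (fun y : ℝ => y) {y | 1 < |y|} ν) (u : ℝ) :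
    levyKhintchineExponent σ ν u - Complex.I * u * ((∫ y in {y : ℝ | 1 < |y|}, y ∂ν : ℝ) : ℂ) =
      -(1 / 2 : ℂ) * (σ : ℂ) ^ 2 * (u : ℂ) ^ 2 + ∫ y, compensatedCexp Set.univ u y ∂ν := by
  have hm : MeasurableSet {y : ℝ | 1 < |y|} := measurableSet_lt measurable_const measurable_norm
  have h : Integrable (fun y => Complex.I * u *
      (({y : ℝ | 1 < |y|}.indicator (fun y => y) y : ℝ) : ℂ)) ν :=
    ((integrable_indicator_iff hm).2 hint).ofReal.const_mul _
  simp only [levyKhintchineExponent_eq, compensatedCexp_eq_sub (Set.subset_univ _) u,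
    Set.univ_inter]
  rw [integral_sub (hν.integrable_compensatedCexp_abs_le_one u) h, integral_const_mul,
    integral_complex_ofReal, integral_indicator hm]
  ring

end LevyMeasure

/-! ### The compensator -/

section Compensator

variable {N : ℕ} {τ : Fin (N + 1) → ℝ≥0} {ν : Fin N → Measure ℝ}

/-- Up to the last date, the jump sizes have intensity `∑ₙ (τₙ - τₙ₋₁) ν⁽ⁿ⁾`. -/
lemma map_fst_restrict_additiveCompensator (hτ : Monotone τ) (hν : ∀ n, SigmaFinite (ν n))
    {A : Set ℝ} (hA : MeasurableSet A) :
    ((additiveCompensator τ ν).restrict (A ×ˢ Set.Icc 0 (τ (Fin.last N) : ℝ))).map Prod.fst =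
      ∑ n : Fin N, ENNReal.ofReal ((τ n.succ : ℝ) - τ n.castSucc) • (ν n).restrict A := by
  rw [additiveCompensator, Measure.restrict_sum _ (hA.prod measurableSet_Icc),
    Measure.map_sum measurable_fst.aemeasurable, Measure.sum_fintype]
  refine Finset.sum_congr rfl fun n _ => ?_
  have := hν n
  have hsub : Set.Icc 0 (τ (Fin.last N) : ℝ) ∩ Set.Ico (τ n.castSucc : ℝ) (τ n.succ : ℝ) =
      Set.Ico (τ n.castSucc : ℝ) (τ n.succ : ℝ) := Set.inter_eq_right.2 fun s hs =>
    ⟨(τ n.castSucc).coe_nonneg.trans hs.1,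
      hs.2.le.trans (NNReal.coe_le_coe.2 (hτ (Fin.le_last _)))⟩
  rw [← Measure.prod_restrict, Measure.restrict_restrict measurableSet_Icc, hsub,
    Measure.map_fst_prod, Measure.restrict_apply_univ, Real.volume_Ico]

lemma additiveCompensator_prod_ne_top (hτ : Monotone τ) (hν : ∀ n, SigmaFinite (ν n))
    {A : Set ℝ} (hA : MeasurableSet A) (hfin : ∀ n, ν n A ≠ ∞) :
    additiveCompensator τ ν (A ×ˢ Set.Icc 0 (τ (Fin.last N) : ℝ)) ≠ ∞ := by
  have h := congrArg (fun m => m Set.univ) (map_fst_restrict_additiveCompensator hτ hν hA)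
  simp only [Measure.map_apply measurable_fst MeasurableSet.univ, Set.preimage_univ,
    Measure.restrict_apply_univ, Measure.coe_finsetSum, Finset.sum_apply, Measure.smul_apply,
    smul_eq_mul] at h
  rw [h]
  exact ENNReal.sum_ne_top.2 fun n _ => ENNReal.mul_ne_top ENNReal.ofReal_ne_top (hfin n)

lemma setIntegral_fst_additiveCompensator (hτ : Monotone τ) (hν : ∀ n, SigmaFinite (ν n))
    {A : Set ℝ} (hA : MeasurableSet A) {F : Type*} [NormedAddCommGroup F] [NormedSpace ℝ F]
    {h : ℝ → F} (hh : ∀ n, IntegrableOn h A (ν n)) :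
    ∫ z in A ×ˢ Set.Icc 0 (τ (Fin.last N) : ℝ), h z.1 ∂(additiveCompensator τ ν) =
      ∑ n : Fin N, ((τ n.succ : ℝ) - τ n.castSucc) • ∫ y in A, h y ∂(ν n) := by
  have hi : ∀ n ∈ Finset.univ, Integrable h
      (ENNReal.ofReal ((τ n.succ : ℝ) - τ n.castSucc) • (ν n).restrict A) :=
    fun n _ => (hh n).integrable.smul_measure ENNReal.ofReal_ne_top
  have hm := map_fst_restrict_additiveCompensator hτ hν hA
  have hmeas : AEStronglyMeasurable h
      (((additiveCompensator τ ν).restrict (A ×ˢ Set.Icc 0 (τ (Fin.last N) : ℝ))).map Prod.fst) := by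
    rw [hm]
    exact (integrable_finsetSum_measure.2 hi).aestronglyMeasurable
  rw [← integral_map measurable_fst.aemeasurable hmeas, hm, integral_finsetSum_measure hi]
  refine Finset.sum_congr rfl fun n _ => ?_
  rw [integral_smul_measure, ENNReal.toReal_ofReal]
  exact sub_nonneg.2 (NNReal.coe_le_coe.2 (hτ (Fin.castSucc_lt_succ).le))

end Compensator

/-! ### The characteristic function of a compensated jump process -/

section JumpProcess

variable {Ω : Type*} [MeasurableSpace Ω] {P : Measure Ω} [IsProbabilityMeasure P] {N : ℕ}
  {τ : Fin (N + 1) → ℝ≥0} {ν : Fin N → Measure ℝ} {M : Ω → Measure (ℝ × ℝ)} {s : Set ℝ}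
  {V : Ω → ℝ}

lemma IsLevyMeasure.integrableOn_inter_lt_abs {ν : Measure ℝ} (hν : IsLevyMeasure ν)
    (hint : IntegrableOn (fun y : ℝ => y) (s ∩ {y | 1 < |y|}) ν) {ε : ℝ} (hε : 0 < ε) :
    IntegrableOn (fun y : ℝ => y) (s ∩ {y | ε < |y|}) ν := by
  have hsmall : IntegrableOn (fun y : ℝ => y) ({y | ε < |y|} ∩ {y | |y| ≤ 1}) ν := by
    refine Measure.integrableOn_of_bounded (M := 1)
      (ne_top_of_le_ne_top (hν.measure_lt_abs_ne_top hε) (measure_mono Set.inter_subset_left))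
      measurable_id.aestronglyMeasurable ?_
    refine (ae_restrict_iff' ((measurableSet_lt measurable_const measurable_norm).inter
      (measurableSet_le measurable_norm measurable_const))).2 (Eventually.of_forall fun y hy => hy.2)
  refine (hint.union hsmall).mono_set fun y hy => ?_
  rcases le_or_gt |y| 1 with h | h
  · exact Or.inr ⟨hy.2, h⟩
  · exact Or.inl ⟨hy.1, h⟩

lemma setIntegral_compensatedCexp {ν : Measure ℝ} (hν : IsLevyMeasure ν) (hsm : MeasurableSet s)
    (hint : IntegrableOn (fun y : ℝ => y) (s ∩ {y | 1 < |y|}) ν) {ε : ℝ} (hε : 0 < ε) (u : ℝ) :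
    IntegrableOn (fun y : ℝ => Complex.exp (Complex.I * u * y) - 1) {y | ε < |y|} ν ∧
    ∫ y in {y | ε < |y|}, compensatedCexp s u y ∂ν =
      ∫ y in {y | ε < |y|}, (Complex.exp (Complex.I * u * y) - 1) ∂ν -
        Complex.I * u * ((∫ y in s ∩ {y | ε < |y|}, y ∂ν : ℝ) : ℂ) := by
  have hm : MeasurableSet {y : ℝ | ε < |y|} := measurableSet_lt measurable_const measurable_norm
  have h1 : IntegrableOn (fun y : ℝ => Complex.exp (Complex.I * u * y) - 1) {y | ε < |y|} ν := by
    refine Measure.integrableOn_of_bounded (M := 2) (hν.measure_lt_abs_ne_top hε)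
      (Measurable.aestronglyMeasurable (by fun_prop)) (Eventually.of_forall fun y => ?_)
    refine (norm_sub_le _ _).trans ?_
    rw [norm_cexp_I_mul_mul, norm_one]
    norm_num
  have h2 : IntegrableOn (fun y : ℝ => Complex.I * u * (y : ℂ)) ({y | ε < |y|} ∩ s) ν := by
    rw [Set.inter_comm]
    exact Integrable.const_mul (hν.integrableOn_inter_lt_abs hint hε).integrable.ofReal _
  have h3 : IntegrableOn (s.indicator fun y : ℝ => Complex.I * u * (y : ℂ)) {y | ε < |y|} ν := by
    rw [IntegrableOn, integrable_indicator_iff hsm, IntegrableOn, Measure.restrict_restrict hsm,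
      Set.inter_comm]
    exact h2
  refine ⟨h1, ?_⟩
  unfold compensatedCexp
  rw [integral_sub h1 h3, setIntegral_indicator hsm, integral_const_mul, integral_complex_ofReal,
    Set.inter_comm]

/-- The jumps larger than `ε`, with those in `s` compensated, form an integral over a set of finite
intensity, so the exponential formula applies; the compensator turns `e^{iuy} - 1` into
`e^{iuy} - 1 - iuy 1_s(y)`. -/
lemma integral_cexp_truncated (hτ : Monotone τ) (hν : ∀ n, IsLevyMeasure (ν n))
    (hM : IsPoissonRandomMeasure P M (additiveCompensator τ ν))
    (hV : AEMeasurable V P) (hVM : IndepFun M V P)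
    (hsm : MeasurableSet s) (hs : {y | |y| ≤ 1} ⊆ s)
    (hint : ∀ n, IntegrableOn (fun y : ℝ => y) (s ∩ {y | 1 < |y|}) (ν n))
    {ε : ℝ} (hε : 0 < ε) (hε1 : ε < 1) (u : ℝ) :
    AEMeasurable (fun ω =>
      jumpIntegral (M ω) (s ∩ {y | ε < |y|}) (τ (Fin.last N)) -
        jumpIntegral (additiveCompensator τ ν) (s ∩ {y | ε < |y|}) (τ (Fin.last N)) +
        jumpIntegral (M ω) sᶜ (τ (Fin.last N)) + V ω) P ∧
    ∫ ω, Complex.exp (Complex.I * u * ((jumpIntegral (M ω) (s ∩ {y | ε < |y|}) (τ (Fin.last N)) -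
        jumpIntegral (additiveCompensator τ ν) (s ∩ {y | ε < |y|}) (τ (Fin.last N)) +
        jumpIntegral (M ω) sᶜ (τ (Fin.last N)) + V ω : ℝ) : ℂ)) ∂P =
      Complex.exp (∑ n : Fin N, ((τ n.succ : ℝ) - τ n.castSucc) •
        ∫ y in {y | ε < |y|}, compensatedCexp s u y ∂(ν n)) *
        ∫ ω, Complex.exp (Complex.I * u * V ω) ∂P := by
  set T : ℝ := ((τ (Fin.last N) : ℝ≥0) : ℝ)
  set Λ := additiveCompensator τ ν
  set A : Set ℝ := {y | ε < |y|}
  set D : Set (ℝ × ℝ) := A ×ˢ Set.Icc 0 T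
  set c : ℝ := jumpIntegral Λ (s ∩ A) T
  have hσ : ∀ n, SigmaFinite (ν n) := fun n => (hν n).sigmaFinite
  have hA : MeasurableSet A := measurableSet_lt measurable_const measurable_norm
  have hD : MeasurableSet D := hA.prod measurableSet_Icc
  have hΛD : Λ D ≠ ∞ :=
    additiveCompensator_prod_ne_top hτ hσ hA fun n => (hν n).measure_lt_abs_ne_top hε
  -- All uncompensated jumps exceed `1 > ε`, so they survive the truncation.
  have hsA : sᶜ ⊆ A := fun y hy => hε1.trans (not_le.1 fun h => hy (hs h))
  have hunion : D = (s ∩ A) ×ˢ Set.Icc 0 T ∪ sᶜ ×ˢ Set.Icc 0 T := by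
    have hcover : s ∩ A ∪ sᶜ = A := by
      ext y
      by_cases hy : y ∈ s
      · simp [hy]
      · simp [hy, hsA hy]
    rw [← Set.union_prod, hcover]
  have hdisj : Disjoint ((s ∩ A) ×ˢ Set.Icc 0 T) (sᶜ ×ˢ Set.Icc 0 T) :=
    Set.disjoint_left.2 fun z hz hz' => hz'.1 hz.1.1
  obtain ⟨φ, hφ, hφM⟩ := hM.exists_measurable_setIntegral hD hΛD (f := Prod.fst) measurable_fst
  have hsplit : (fun ω => jumpIntegral (M ω) (s ∩ A) T - c + jumpIntegral (M ω) sᶜ T + V ω) =ᵐ[P]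
      fun ω => φ (M ω) - c + V ω := by
    filter_upwards [hφM, hM.ae_integrableOn hD hΛD (f := Prod.fst) measurable_fst] with ω h1 h2
    have h3 : ∫ z in D, z.1 ∂(M ω) = jumpIntegral (M ω) (s ∩ A) T + jumpIntegral (M ω) sᶜ T := by
      rw [hunion] at h2 ⊢
      exact setIntegral_union hdisj (hsm.compl.prod measurableSet_Icc)
        (h2.mono_set Set.subset_union_left) (h2.mono_set Set.subset_union_right)
    have h4 : ∫ z in D, z.1 ∂(M ω) = φ (M ω) := h1
    rw [← h4, h3]
    ring
  have hφm : AEMeasurable (fun ω => φ (M ω)) P := (hφ.comp hM.measurable).aemeasurable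
  refine ⟨((hφm.sub_const c).add hV).congr hsplit.symm, ?_⟩
  have hcomp : ∀ n, _ := fun n => setIntegral_compensatedCexp (hν n) hsm (hint n) hε u
  have hchar : ∫ ω, Complex.exp (Complex.I * u * (φ (M ω) : ℂ)) ∂P =
      Complex.exp (∑ n : Fin N, ((τ n.succ : ℝ) - τ n.castSucc) •
        ∫ y in A, (Complex.exp (Complex.I * u * y) - 1) ∂(ν n)) := by
    rw [← setIntegral_fst_additiveCompensator hτ hσ hA fun n => (hcomp n).1]
    refine Eq.trans (integral_congr_ae ?_)
      (hM.integral_cexp_setIntegral hD hΛD (f := Prod.fst) measurable_fst u)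
    filter_upwards [hφM] with ω hω
    have h4 : ∫ z in D, z.1 ∂(M ω) = φ (M ω) := hω
    rw [h4]
  have hc : c = ∑ n : Fin N, ((τ n.succ : ℝ) - τ n.castSucc) • ∫ y in s ∩ A, y ∂(ν n) :=
    setIntegral_fst_additiveCompensator hτ hσ (h := fun y : ℝ => y) (hsm.inter hA) fun n =>
      (hν n).integrableOn_inter_lt_abs (hint n) hε
  have hcexp : Measurable fun x : ℝ => Complex.exp (Complex.I * u * x) := by fun_prop
  have hmul := (hVM.comp (hcexp.comp hφ) hcexp).integral_fun_mul_eq_mul_integral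
    (hcexp.comp_aemeasurable hφm).aestronglyMeasurable
    (hcexp.comp_aemeasurable hV).aestronglyMeasurable
  simp only [Function.comp_apply] at hmul
  have hfactor : ∀ᵐ ω ∂P, Complex.exp (Complex.I * u *
      ((jumpIntegral (M ω) (s ∩ A) T - c + jumpIntegral (M ω) sᶜ T + V ω : ℝ) : ℂ)) =
      Complex.exp (-(Complex.I * u * c)) *
        (Complex.exp (Complex.I * u * φ (M ω)) * Complex.exp (Complex.I * u * V ω)) := by
    filter_upwards [hsplit] with ω hω
    rw [hω, ← Complex.exp_add, ← Complex.exp_add]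
    congr 1
    push_cast
    ring
  rw [integral_congr_ae hfactor, integral_const_mul, hmul, hchar, ← mul_assoc, ← Complex.exp_add]
  congr 2
  rw [hc, Complex.ofReal_sum, Finset.mul_sum, ← Finset.sum_neg_distrib, ← Finset.sum_add_distrib]
  refine Finset.sum_congr rfl fun n _ => ?_
  rw [(hcomp n).2]
  simp only [Complex.real_smul, smul_eq_mul]
  push_cast
  ring

/-- Along a sequence `εₖ ↓ 0` for which the compensated sums converge almost surely, the truncated
characteristic functions converge on both sides by dominated convergence. -/
lemma integral_cexp_compensated (hτ : Monotone τ) (hν : ∀ n, IsLevyMeasure (ν n))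
    (hM : IsPoissonRandomMeasure P M (additiveCompensator τ ν))
    (hV : AEMeasurable V P) (hVM : IndepFun M V P)
    (hsm : MeasurableSet s) (hs : {y | |y| ≤ 1} ⊆ s)
    (hint : ∀ n, IntegrableOn (fun y : ℝ => y) (s ∩ {y | 1 < |y|}) (ν n)) {Y : Ω → ℝ}
    (hY : IsCompensatedJumpIntegral P M (additiveCompensator τ ν) s (τ (Fin.last N)) Y) (u : ℝ) :
    ∫ ω, Complex.exp (Complex.I * u *
        ((Y ω + jumpIntegral (M ω) sᶜ (τ (Fin.last N)) + V ω : ℝ) : ℂ)) ∂P =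
      Complex.exp (∑ n : Fin N, ((τ n.succ : ℝ) - τ n.castSucc) •
        ∫ y, compensatedCexp s u y ∂(ν n)) * ∫ ω, Complex.exp (Complex.I * u * V ω) ∂P := by
  obtain ⟨ε, hε, hae⟩ := hY.exists_seq_tendsto_ae'
  have hε01 : ∀ᶠ k in atTop, 0 < ε k ∧ ε k < 1 :=
    hε.eventually (Ioo_mem_nhdsGT one_pos)
  have htrunc := fun k (hk : 0 < ε k ∧ ε k < 1) =>
    integral_cexp_truncated hτ hν hM hV hVM hsm hs hint hk.1 hk.2 u
  have hcont : Continuous fun x : ℝ => Complex.exp (Complex.I * u * x) := by fun_prop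
  have hlim : Tendsto (fun k => Complex.exp (∑ n : Fin N, ((τ n.succ : ℝ) - τ n.castSucc) •
        ∫ y in {y | ε k < |y|}, compensatedCexp s u y ∂(ν n)) *
        ∫ ω, Complex.exp (Complex.I * u * V ω) ∂P) atTop
      (𝓝 (Complex.exp (∑ n : Fin N, ((τ n.succ : ℝ) - τ n.castSucc) •
        ∫ y, compensatedCexp s u y ∂(ν n)) * ∫ ω, Complex.exp (Complex.I * u * V ω) ∂P)) := by
    refine Tendsto.mul_const _ ((Complex.continuous_exp.tendsto _).comp ?_)
    refine tendsto_finsetSum _ fun n _ => Tendsto.const_smul ?_ _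
    exact ((hν n).tendsto_setIntegral_lt_abs
      ((hν n).integrable_compensatedCexp hsm hs (hint n) u)).comp hε
  refine tendsto_nhds_unique ?_
    (hlim.congr' (hε01.mono fun k hk => (htrunc k hk).2.symm))
  refine tendsto_integral_filter_of_dominated_convergence (fun _ => 1)
    (hε01.mono fun k hk =>
      (hcont.measurable.comp_aemeasurable (htrunc k hk).1).aestronglyMeasurable)
    (Eventually.of_forall fun k => Eventually.of_forall fun ω => (norm_cexp_I_mul_mul u _).le)
    (integrable_const _) ?_
  filter_upwards [hae] with ω hω
  exact (hcont.tendsto _).comp ((hω.add_const _).add_const _)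

/-- The characteristic function of a process in Lévy–Itô form whose jumps in `s ⊇ {|y| ≤ 1}` are
compensated, at the last date. -/
lemma integral_cexp_levyIto (hτ : Monotone τ) (hν : ∀ n, IsLevyMeasure (ν n)) {σ : Fin N → ℝ}
    {W : ℝ≥0 → Ω → ℝ} (hW : IsPreBrownianReal W P)
    (hM : IsPoissonRandomMeasure P M (additiveCompensator τ ν))
    (hWM : IndepFun (fun ω t => W t ω) M P)
    (hsm : MeasurableSet s) (hs : {y | |y| ≤ 1} ⊆ s)
    (hint : ∀ n, IntegrableOn (fun y : ℝ => y) (s ∩ {y | 1 < |y|}) (ν n)) {Y : Ω → ℝ}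
    (hY : IsCompensatedJumpIntegral P M (additiveCompensator τ ν) s (τ (Fin.last N)) Y) (u : ℝ) :
    ∫ ω, Complex.exp (Complex.I * u * ((Y ω + jumpIntegral (M ω) sᶜ (τ (Fin.last N)) +
        stepWienerIntegral τ σ W (τ (Fin.last N)) ω : ℝ) : ℂ)) ∂P =
      Complex.exp (∑ n : Fin N, (-(1 / 2 : ℂ) * (σ n : ℂ) ^ 2 * (u : ℂ) ^ 2 +
        ∫ y, compensatedCexp s u y ∂(ν n)) * ((τ n.succ : ℂ) - (τ n.castSucc : ℂ))) := by
  have hψ : Measurable fun w : ℝ≥0 → ℝ => ∑ n : Fin N, σ n *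
      (w (min (τ (Fin.last N)) (τ n.succ)) - w (min (τ (Fin.last N)) (τ n.castSucc))) := by
    fun_prop
  have hind : IndepFun M (stepWienerIntegral τ σ W (τ (Fin.last N))) P :=
    hWM.symm.comp measurable_id hψ
  rw [integral_cexp_compensated hτ hν hM (aemeasurable_stepWienerIntegral hW _) hind hsm hs hint hY,
    integral_cexp_stepWienerIntegral hτ hW, ← Complex.exp_add, ← Finset.sum_add_distrib]
  congr 1
  refine Finset.sum_congr rfl fun n _ => ?_
  rw [Complex.real_smul]
  push_cast
  ring

end JumpProcess

theorem proposition2 {Ω : Type*} [MeasurableSpace Ω] (P : Measure Ω) [IsProbabilityMeasure P]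
    (N : ℕ) (τ : Fin (N + 1) → ℝ≥0) (hτ0 : τ 0 = 0) (hτ : StrictMono τ)
    (σ : Fin N → ℝ) (ν : Fin N → Measure ℝ) (hν : ∀ n, IsLevyMeasure (ν n))
    (W : ℝ≥0 → Ω → ℝ) (hW : IsBrownianReal W P)
    (M : Ω → Measure (ℝ × ℝ)) (hM : IsPoissonRandomMeasure P M (additiveCompensator τ ν))
    (hWM : IndepFun (fun ω t => W t ω) M P)
    (X : ℝ≥0 → Ω → ℝ) :
    (IsLevyAdditive P τ σ ν W M X →
      ∀ u : ℝ, ∫ ω, Complex.exp (Complex.I * u * X (τ (Fin.last N)) ω) ∂P =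
        Complex.exp (∑ n : Fin N,
          levyKhintchineExponent (σ n) (ν n) u * ((τ n.succ : ℂ) - (τ n.castSucc : ℂ)))) ∧
    ((∀ n, IntegrableOn (fun y : ℝ => y) {y | 1 < |y|} (ν n)) →
      IsFullyCompensatedLevyAdditive P τ σ ν W M X →
      ∀ u : ℝ, ∫ ω, Complex.exp (Complex.I * u * X (τ (Fin.last N)) ω) ∂P =
        Complex.exp (∑ n : Fin N,
          (levyKhintchineExponent (σ n) (ν n) u
            - Complex.I * u * ((∫ y in {y : ℝ | 1 < |y|}, y ∂(ν n) : ℝ) : ℂ))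
            * ((τ n.succ : ℂ) - (τ n.castSucc : ℂ)))) := by
  have hW' := hW.toIsPreBrownianReal
  have hle : MeasurableSet {y : ℝ | |y| ≤ 1} := measurableSet_le measurable_norm measurable_const
  have hcompl : {y : ℝ | |y| ≤ 1}ᶜ = {y | 1 < |y|} := by
    ext y
    simp
  refine ⟨fun hX u => ?_, fun hint hX u => ?_⟩
  · obtain ⟨Y, hY, hXY⟩ := hX _ le_rfl
    have hempty : {y : ℝ | |y| ≤ 1} ∩ {y | 1 < |y|} = ∅ := by
      rw [← hcompl, Set.inter_compl_self]
    have h := integral_cexp_levyIto (σ := σ) hτ.monotone hν hW' hM hWM hle subset_rfl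
      (fun n => by simp [hempty]) hY u
    simp only [levyKhintchineExponent_eq]
    rw [← h, hcompl]
    exact integral_congr_ae (hXY.mono fun ω hω => by simp only [hω])
  · obtain ⟨Y, hY, hXY⟩ := hX _ le_rfl
    have h := integral_cexp_levyIto (σ := σ) hτ.monotone hν hW' hM hWM MeasurableSet.univ
      (Set.subset_univ _) (fun n => by simpa using hint n) hY u
    simp only [fun n => levyKhintchineExponent_sub_eq (hν n) (σ n) (hint n) u]
    rw [← h]
    refine integral_congr_ae (hXY.mono fun ω hω => ?_)
    simp only [hω, jumpIntegral, Set.compl_univ, Set.empty_prod, Measure.restrict_empty,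
      integral_zero_measure, add_zero]
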